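/- The fork is the five-vertex tree obtained from a four-vertex path by adding a vertex adjacent to the second vertex of the path, and the antifork is its complement graph. A finite simple graph $G$ is uncluttered if no induced subgraph of $G$ is isomorphic to the fork or the antifork. For a finite simple graph $G$, let $\chi(G)$ denote its chromatic number and $\omega(G)$ the number of vertices in a largest clique of $G$. Theorem. Every uncluttered finite simple graph $G$ satisfies $\chi(G) \le 2\,\omega(G)$. -/

import Mathlib

/-- The fork: the four-vertex path `0 - 1 - 2 - 3` together with one more vertex `4`
adjacent to the second vertex `1` of the path (the claw with one edge subdivided once). -/
def forkGraph : SimpleGraph (Fin 5) :=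
  SimpleGraph.fromEdgeSet {s(0, 1), s(1, 2), s(2, 3), s(1, 4)}

/-- The antifork: the complement of the fork. -/
def antiforkGraph : SimpleGraph (Fin 5) := forkGraphᶜ

/-- A graph is uncluttered if none of its induced subgraphs is (isomorphic to) a fork or an
antifork. -/
def Uncluttered {V : Type*} (G : SimpleGraph V) : Prop :=
  ¬ forkGraph.IsIndContained G ∧ ¬ antiforkGraph.IsIndContained G

/-! Consider a minimal counterexample with clique number at most `m`. If the non-neighbours of some
`v` induce a bipartite graph, then `N(v)` has clique number at most `m - 1`, so `2(m - 1)` colours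
for it and two more for the rest suffice. If `N(v)` is a union of two cliques, `v` has degree at
most `2(m - 1)` and a colouring of the other vertices extends to it. It is enough to find one such
`v`.

Minimality makes the graph prime. A maximal proper module with both an edge and a non-edge
contradicts fork- and antifork-freeness, using that the graph and its complement are connected.
Since no vertex is dominated by a nonadjacent one, any other nontrivial module is a clique, and a
clique module would yield a nontrivial module that is not a clique.

In a prime uncluttered graph every claw centre has a bipartite non-neighbourhood
(`IsClawAt.bipartiteOn_nonNbrs`): a triangle there is excluded by counting a 3 by 3 adjacency
matrix, and an odd-cycle component would force a nontrivial module. If there is no claw at all,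
`bipartiteOn_nonNbrs_of_no_compl_claw`, applied to the complement, splits each `N(v)` into two
cliques. -/

namespace Uncluttered

variable {V : Type*} {G : SimpleGraph V}

/-! ### Forks, antiforks and complementation -/

/-- Explicit form of having no induced fork: centre `c`, leaves `l₁`, `l₂`, and the path `c - p - e`. -/
def ForkFree (G : SimpleGraph V) : Prop :=
  ∀ c l₁ l₂ p e, l₁ ≠ l₂ → G.Adj c l₁ → G.Adj c l₂ → G.Adj c p → G.Adj p e →
    ¬ G.Adj l₁ l₂ → ¬ G.Adj l₁ p → ¬ G.Adj l₂ p → ¬ G.Adj e c → ¬ G.Adj e l₁ → ¬ G.Adj e l₂ → False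

/-- Explicit form of having no induced antifork: the diamond with middle edge `x y` and opposite
vertices `k`, `w`, together with a pendant vertex `q` at `k`. -/
def KiteFree (G : SimpleGraph V) : Prop :=
  ∀ x y k w q, G.Adj x y → G.Adj k x → G.Adj k y → G.Adj w x → G.Adj w y → G.Adj q k →
    k ≠ w → ¬ G.Adj k w → ¬ G.Adj q x → ¬ G.Adj q y → ¬ G.Adj q w → False

theorem forkGraph_adj (i j : Fin 5) : forkGraph.Adj i j ↔
    (i = 0 ∧ j = 1 ∨ i = 1 ∧ j = 0 ∨ i = 1 ∧ j = 2 ∨ i = 2 ∧ j = 1 ∨ i = 2 ∧ j = 3 ∨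
      i = 3 ∧ j = 2 ∨ i = 1 ∧ j = 4 ∨ i = 4 ∧ j = 1) := by
  simp only [forkGraph, SimpleGraph.fromEdgeSet_adj, Set.mem_insert_iff, Set.mem_singleton_iff,
    Sym2.eq_iff]
  revert i j
  decide

theorem isIndContained_forkGraph {c l₁ l₂ p e : V} (hl : l₁ ≠ l₂) (h1 : G.Adj c l₁)
    (h2 : G.Adj c l₂) (h3 : G.Adj c p) (h4 : G.Adj p e) (n1 : ¬ G.Adj l₁ l₂) (n2 : ¬ G.Adj l₁ p)
    (n3 : ¬ G.Adj l₂ p) (n4 : ¬ G.Adj e c) (n5 : ¬ G.Adj e l₁) (n6 : ¬ G.Adj e l₂) :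
    forkGraph.IsIndContained G := by
  have n1' : ¬ G.Adj l₂ l₁ := fun h => n1 h.symm
  have n2' : ¬ G.Adj p l₁ := fun h => n2 h.symm
  have n3' : ¬ G.Adj p l₂ := fun h => n3 h.symm
  have n4' : ¬ G.Adj c e := fun h => n4 h.symm
  have n5' : ¬ G.Adj l₁ e := fun h => n5 h.symm
  have n6' : ¬ G.Adj l₂ e := fun h => n6 h.symm
  have d1 : l₁ ≠ p := by rintro rfl; exact n5 h4.symm
  have d2 : l₂ ≠ p := by rintro rfl; exact n6 h4.symm
  have d3 : e ≠ c := by rintro rfl; exact n5 h1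
  have d4 : e ≠ l₁ := by rintro rfl; exact n2 h4.symm
  have d5 : e ≠ l₂ := by rintro rfl; exact n3 h4.symm
  refine ⟨⟨⟨![l₁, c, p, e, l₂], ?_⟩, ?_⟩⟩
  · intro i j hij
    fin_cases i <;> fin_cases j <;>
      simp_all [h1.ne, h1.ne', h2.ne, h2.ne', h3.ne, h3.ne', h4.ne, h4.ne', eq_comm]
  · intro i j
    change G.Adj (![l₁, c, p, e, l₂] i) (![l₁, c, p, e, l₂] j) ↔ _
    rw [forkGraph_adj]
    fin_cases i <;> fin_cases j <;>
      simp [h1, h2, h3, h4, h1.symm, h2.symm, h3.symm, h4.symm, n1, n2, n3, n4, n5, n6,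
        n1', n2', n3', n4', n5', n6']

theorem compl (hG : Uncluttered G) : Uncluttered Gᶜ := by
  constructor
  · intro h
    exact hG.2 (by simpa [antiforkGraph] using SimpleGraph.compl_isIndContained_compl.2 h)
  · intro h
    exact hG.1 (SimpleGraph.compl_isIndContained_compl.1 h)

theorem forkFree (hG : Uncluttered G) : ForkFree G := by
  intro c l₁ l₂ p e h0 h1 h2 h3 h4 n1 n2 n3 n4 n5 n6
  exact hG.1 (isIndContained_forkGraph h0 h1 h2 h3 h4 n1 n2 n3 n4 n5 n6)

theorem kiteFree (hG : Uncluttered G) : KiteFree G := by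
  intro x y k w q h1 h2 h3 h4 h5 h6 h7 n1 n2 n3 n4
  have d1 : q ≠ x := by rintro rfl; exact n3 h1
  have d2 : q ≠ y := by rintro rfl; exact n2 h1.symm
  have d3 : q ≠ w := by rintro rfl; exact n2 h4
  -- In the complement the kite becomes the fork with centre `q`, leaves `x`, `y` and path `q - w -
  -- k`.
  refine hG.compl.forkFree q x y w k h1.ne ?_ ?_ ?_ ?_ ?_ ?_ ?_ ?_ ?_ ?_ <;>
    (simp_all [SimpleGraph.compl_adj, G.adj_comm, h2.ne, h3.ne]; try tauto)

theorem induce (hG : Uncluttered G) (s : Set V) : Uncluttered (G.induce s) :=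
  ⟨fun h => hG.1 (h.trans ⟨SimpleGraph.Embedding.induce s⟩),
   fun h => hG.2 (h.trans ⟨SimpleGraph.Embedding.induce s⟩)⟩

/-! ### Modules, primeness and components -/

/-- A module: every vertex outside `X` is complete or anticomplete to `X`. -/
def IsModule (G : SimpleGraph V) (X : Set V) : Prop :=
  ∀ v ∉ X, ∀ x ∈ X, ∀ y ∈ X, G.Adj v x → G.Adj v y

/-- A graph is prime if all its proper modules are trivial. -/
def IsPrime (G : SimpleGraph V) : Prop :=
  ∀ X : Set V, IsModule G X → X ≠ Set.univ → X.Subsingleton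

theorem IsModule.compl {X : Set V} (h : IsModule G X) : IsModule Gᶜ X := by
  intro v hv x hx y hy hvx
  rw [SimpleGraph.compl_adj] at hvx ⊢
  exact ⟨fun e => hv (e ▸ hy), fun e => hvx.2 (h v hv y hy x hx e)⟩

theorem IsPrime.compl (h : IsPrime G) : IsPrime Gᶜ := by
  intro X hX
  exact h X (by simpa using hX.compl)

/-- The component of `t` in the subgraph induced on `U`. -/
theorem exists_component (G : SimpleGraph V) {U : Set V} {t : V} (ht : t ∈ U) :
    ∃ D ⊆ U, t ∈ D ∧ (∀ x ∈ D, ∀ y ∈ U, G.Adj x y → y ∈ D) ∧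
      ∀ p : V → Prop, (∀ x ∈ D, ∀ y ∈ D, G.Adj x y → p x → p y) → ∀ x ∈ D, ∀ y ∈ D, p x → p y := by
  let R : V → V → Prop := fun a b => G.Adj a b ∧ b ∈ U
  let D : Set V := {x | Relation.ReflTransGen R t x}
  have hDU : D ⊆ U := by
    intro x hx
    rcases hx.cases_tail with rfl | ⟨c, _, hc⟩
    · exact ht
    · exact hc.2
  have key : ∀ q : V → Prop, (∀ x ∈ D, ∀ y ∈ D, G.Adj x y → q x → q y) → q t →
      ∀ x ∈ D, q x := by
    intro q hq ht x hx
    have hx' : Relation.ReflTransGen R t x := hx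
    clear hx
    induction hx' with
    | refl => exact ht
    | @tail b c hb hc ih => exact hq b hb c (hb.tail hc) hc.1 ih
  refine ⟨D, hDU, Relation.ReflTransGen.refl, ?_, ?_⟩
  · intro x hx y hy hxy
    exact Relation.ReflTransGen.tail hx ⟨hxy, hy⟩
  · intro p hp x hx y hy hpx
    have htp : p t := by
      by_contra hn
      exact key (fun z => ¬ p z) (fun a ha b hb hab h h' => h (hp b hb a ha hab.symm h')) hn x hx hpx
    exact key p hp htp y hy

/-! ### Claws, and triangles anticomplete to their centre -/

/-- The vertices `s i` are three pairwise nonadjacent neighbours of `v`. -/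
structure IsClawAt (G : SimpleGraph V) (v : V) (s : Fin 3 → V) : Prop where
  inj : ∀ i j, i ≠ j → s i ≠ s j
  adj : ∀ i, G.Adj v (s i)
  indep : ∀ i j, ¬ G.Adj (s i) (s j)

theorem two_or_two (p : Fin 3 → Prop) :
    (∃ i j, i ≠ j ∧ p i ∧ p j) ∨ ∃ i j, i ≠ j ∧ ¬ p i ∧ ¬ p j := by
  have h01 : (0 : Fin 3) ≠ 1 := by decide
  have h02 : (0 : Fin 3) ≠ 2 := by decide
  have h12 : (1 : Fin 3) ≠ 2 := by decide
  by_cases h0 : p 0 <;> by_cases h1 : p 1 <;> by_cases h2 : p 2 <;> grind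

theorem exists_others (i : Fin 3) : ∃ j k, j ≠ i ∧ k ≠ i ∧ j ≠ k := by
  revert i; decide

/-- Otherwise `m`, attached at `s i`, subdivides a claw edge into a fork centred at `v`. -/
theorem IsClawAt.adj_or_adj (hF : ForkFree G) {v : V} {s : Fin 3 → V} (hs : IsClawAt G v s) {m : V}
    (hm : ¬ G.Adj m v) {i j k : Fin 3} (h : G.Adj m (s i)) (hjk : j ≠ k) : G.Adj m (s j) ∨ G.Adj m (s k) := by
  by_contra! hn
  exact hF v (s j) (s k) (s i) m (hs.inj _ _ hjk) (hs.adj j) (hs.adj k) (hs.adj i) h.symm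
    (hs.indep _ _) (hs.indep _ _) (hs.indep _ _) hm hn.1 hn.2

theorem IsClawAt.two_nbrs (hF : ForkFree G) {v : V} {s : Fin 3 → V} (hs : IsClawAt G v s) {m : V}
    (hm : ¬ G.Adj m v) {i : Fin 3} (h : G.Adj m (s i)) :
    ∃ j k, j ≠ k ∧ G.Adj m (s j) ∧ G.Adj m (s k) := by
  obtain ⟨j, k, hj, hk, hjk⟩ := exists_others i
  rcases hs.adj_or_adj hF hm h hjk with h' | h'
  · exact ⟨i, j, hj.symm, h, h'⟩
  · exact ⟨i, k, hk.symm, h, h'⟩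

/-- No neighbour of a claw centre distinguishes an edge anticomplete to the claw. -/
theorem IsClawAt.not_distinguish (hF : ForkFree G) {v : V} {s : Fin 3 → V} (hs : IsClawAt G v s)
    {w d e : V} (hde : G.Adj d e) (hwd : G.Adj w d) (hwe : ¬ G.Adj w e) (hvd : ¬ G.Adj v d)
    (hd : ∀ i, ¬ G.Adj d (s i)) (he : ∀ i, ¬ G.Adj e (s i))
    (hw : G.Adj w v ∨ ∃ i, G.Adj w (s i)) : False := by
  have two : (∃ i j, i ≠ j ∧ G.Adj w (s i) ∧ G.Adj w (s j)) → False := by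
    rintro ⟨i, j, hij, hi, hj⟩
    exact hF w (s i) (s j) d e (hs.inj _ _ hij) hi hj hwd hde (hs.indep _ _)
      (fun h => hd _ h.symm) (fun h => hd _ h.symm) (fun h => hwe h.symm) (he _) (he _)
  by_cases hwv : G.Adj w v
  · rcases two_or_two (fun i => G.Adj w (s i)) with h | ⟨i, j, hij, hi, hj⟩
    · exact two h
    · exact hF v (s i) (s j) w d (hs.inj _ _ hij) (hs.adj i) (hs.adj j) hwv.symm hwd
        (hs.indep _ _) (fun h => hi h.symm) (fun h => hj h.symm) (fun h => hvd h.symm) (hd _) (hd _)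
  · obtain ⟨i, hi⟩ := hw.resolve_left hwv
    exact two (hs.two_nbrs hF hwv hi)

/-- In a prime graph the vertices anticomplete to a claw form a stable set. -/
theorem IsClawAt.anticomplete_indep (hF : ForkFree G) (hP : IsPrime G) {v : V} {s : Fin 3 → V}
    (hs : IsClawAt G v s) {t t' : V} (hvt : ¬ G.Adj v t) (hvt' : ¬ G.Adj v t')
    (ht : ∀ i, ¬ G.Adj t (s i)) (ht' : ∀ i, ¬ G.Adj t' (s i)) : ¬ G.Adj t t' := by
  intro htt
  let U : Set V := {x | ¬ G.Adj v x ∧ ∀ i, ¬ G.Adj x (s i)}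
  have htv : t ∈ U := ⟨hvt, ht⟩
  -- The component `D` is a module: an outside vertex with a neighbour in `D` is not in `U`, so it
  -- sees the claw and cannot distinguish an edge of `D`.
  obtain ⟨D, hDU, htD, hclosed, hconn⟩ := exists_component G htv
  have ht'D : t' ∈ D := hclosed t htD t' ⟨hvt', ht'⟩ htt
  have hvD : v ∉ D := fun h => (hDU h).2 0 (hs.adj 0)
  refine htt.ne (hP D ?_ (fun h => hvD (h ▸ Set.mem_univ v)) htD ht'D)
  intro w hw x hx y hy hwx
  refine hconn (fun z => G.Adj w z) ?_ x hx y hy hwx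
  intro d hd e he hde hwd
  by_contra hwe
  refine hs.not_distinguish hF hde hwd hwe (hDU hd).1 (hDU hd).2 (hDU he).2 ?_
  by_contra! hn
  exact hw (hclosed d hd w ⟨fun h => hn.1 h.symm, hn.2⟩ hwd.symm)

/-- Count the ones. Row sums are 0, 2 or 3, with at most one 0, so the total is at least 4. Column
sums are 0, 1 or 3, with at most one 3, so the total is at most 5 and some column is full. A full
column excludes zero rows, making the total at least 6. -/
theorem no_matrix (A : Fin 3 → Fin 3 → Prop)
    (row : ∀ l i j k, A l i → j ≠ k → A l j ∨ A l k)
    (col : ∀ l i j k, ¬ A i l → j ≠ k → ¬ A j l ∨ ¬ A k l)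
    (zero : ∀ i j, i ≠ j → ∃ k, A i k ∨ A j k)
    (full : ∀ i j, i ≠ j → ∃ k, ¬ A k i ∨ ¬ A k j) : False := by
  have r := fun l => And.intro (row l 0 1 2 · (by decide)) (And.intro (row l 1 0 2 · (by decide)) (row l 2 0 1 · (by decide)))
  have c := fun l => And.intro (col l 0 1 2 · (by decide)) (And.intro (col l 1 0 2 · (by decide)) (col l 2 0 1 · (by decide)))
  have z01 := zero 0 1 (by decide)
  have z02 := zero 0 2 (by decide)
  have z12 := zero 1 2 (by decide)
  have f01 := full 0 1 (by decide)
  have f02 := full 0 2 (by decide)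
  have f12 := full 1 2 (by decide)
  have r0 := r 0
  have r1 := r 1
  have r2 := r 2
  have c0 := c 0
  have c1 := c 1
  have c2 := c 2
  clear row col zero full r c
  simp only [Fin.exists_fin_succ, Fin.isValue, Fin.succ_zero_eq_one,Fin.succ_one_eq_two, IsEmpty.exists_iff, or_false] at *
  grind (splits := 40)

/-- In a prime uncluttered graph, the non-neighbourhood of a claw centre contains no triangle. -/
theorem IsClawAt.false_of_compl (hG : Uncluttered G) (hP : IsPrime G) {v : V} {s t : Fin 3 → V}
    (hs : IsClawAt G v s) (ht : IsClawAt Gᶜ v t) : False := by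
  have hst : ∀ i j, s i ≠ t j := by
    intro i j h
    exact ((SimpleGraph.compl_adj _ _ _).1 (ht.adj j)).2 (h ▸ hs.adj i)
  have hvt : ∀ j, ¬ G.Adj v (t j) := fun j => ((SimpleGraph.compl_adj _ _ _).1 (ht.adj j)).2
  have hvs : ∀ j, ¬ Gᶜ.Adj v (s j) := fun j h => ((SimpleGraph.compl_adj _ _ _).1 h).2 (hs.adj j)
  have htt : ∀ i j, i ≠ j → G.Adj (t i) (t j) := by
    intro i j hij
    by_contra h
    exact ht.indep i j ((SimpleGraph.compl_adj _ _ _).2 ⟨ht.inj i j hij, h⟩)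
  have hss : ∀ i j, i ≠ j → Gᶜ.Adj (s i) (s j) := fun i j hij =>
    (SimpleGraph.compl_adj _ _ _).2 ⟨hs.inj i j hij, hs.indep i j⟩
  have hc : ∀ i j, Gᶜ.Adj (s i) (t j) ↔ ¬ G.Adj (t j) (s i) := by
    intro i j
    rw [SimpleGraph.compl_adj, G.adj_comm]
    simp [hst i j]
  have row : ∀ l i j k, G.Adj (t l) (s i) → j ≠ k →
      G.Adj (t l) (s j) ∨ G.Adj (t l) (s k) := fun l i j k h =>
    hs.adj_or_adj hG.forkFree (fun h => hvt l h.symm) h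
  have col : ∀ l i j k, ¬ G.Adj (t i) (s l) → j ≠ k →
      ¬ G.Adj (t j) (s l) ∨ ¬ G.Adj (t k) (s l) := by
    intro l i j k h hjk
    simpa only [hc] using
      ht.adj_or_adj hG.compl.forkFree (fun h => hvs l h.symm) ((hc _ _).2 h) hjk
  have zero : ∀ i j, i ≠ j → ∃ k, G.Adj (t i) (s k) ∨ G.Adj (t j) (s k) := by
    intro i j hij
    by_contra! hn
    exact hs.anticomplete_indep hG.forkFree hP (hvt i) (hvt j) (fun k => (hn k).1)
      (fun k => (hn k).2) (htt i j hij)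
  have full : ∀ i j, i ≠ j → ∃ k, ¬ G.Adj (t k) (s i) ∨ ¬ G.Adj (t k) (s j) := by
    intro i j hij
    by_contra! hn
    exact ht.anticomplete_indep hG.compl.forkFree hP.compl (hvs i) (hvs j)
      (fun k => by simpa only [hc, not_not] using (hn k).1)
      (fun k => by simpa only [hc, not_not] using (hn k).2) (hss i j hij)
  exact no_matrix (fun l i => G.Adj (t l) (s i)) row col zero full

/-! ### Triangle-free fork-free graphs: bipartite or odd cycles -/

/-- The subgraph induced on `C` is bipartite. -/
def BipartiteOn (G : SimpleGraph V) (C : Set V) : Prop :=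
  ∃ f : V → Bool, ∀ x ∈ C, ∀ y ∈ C, G.Adj x y → f x ≠ f y

/-- The subgraph induced on `C` is connected: a property preserved along edges is constant. -/
def ConnectedOn (G : SimpleGraph V) (C : Set V) : Prop :=
  ∀ p : V → Prop, (∀ x ∈ C, ∀ y ∈ C, G.Adj x y → p x → p y) → ∀ x ∈ C, ∀ y ∈ C, p x → p y

def TriangleFreeOn (G : SimpleGraph V) (C : Set V) : Prop :=
  ∀ x ∈ C, ∀ y ∈ C, ∀ z ∈ C, G.Adj x y → G.Adj y z → G.Adj x z → False

theorem BipartiteOn.mono {C D : Set V} (h : BipartiteOn G D) (hCD : C ⊆ D) : BipartiteOn G C := by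
  obtain ⟨f, hf⟩ := h
  exact ⟨f, fun x hx y hy => hf x (hCD hx) y (hCD hy)⟩

/-- A connected triangle-free fork-free graph with a vertex of degree at least three is bipartite. -/
theorem bipartiteOn_of_three_nbrs (hF : ForkFree G) {C : Set V} (hC : ConnectedOn G C)
    (hT : TriangleFreeOn G C) {a b₁ b₂ b₃ : V} (ha : a ∈ C) (h1 : b₁ ∈ C) (h2 : b₂ ∈ C)
    (h3 : b₃ ∈ C) (a1 : G.Adj a b₁) (a2 : G.Adj a b₂) (a3 : G.Adj a b₃) (h12 : b₁ ≠ b₂)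
    (h13 : b₁ ≠ b₃) (h23 : b₂ ≠ b₃) : BipartiteOn G C := by
  classical
  -- `B`, `D`, `E` are the vertices at distance 1, 2, 3 from `a`. A vertex of `D` misses at most one
  -- vertex of `B`, so it has two neighbours there; this makes `D` stable and stops the levels at
  -- `E`. The 2-colouring is by parity of distance.
  let B : Set V := {b | b ∈ C ∧ G.Adj a b}
  let D : Set V := {d | d ∈ C ∧ d ≠ a ∧ d ∉ B ∧ ∃ b ∈ B, G.Adj d b}
  let E : Set V := {e | e ∈ C ∧ e ≠ a ∧ e ∉ B ∧ e ∉ D ∧ ∃ d ∈ D, G.Adj e d}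
  have hBB : ∀ b ∈ B, ∀ b' ∈ B, ¬ G.Adj b b' := fun b hb b' hb' h =>
    hT a ha b hb.1 b' hb'.1 hb.2 h hb'.2
  have hD : ∀ d ∈ D, ∀ b ∈ B, ∀ b' ∈ B, b ≠ b' → G.Adj d b ∨ G.Adj d b' := by
    rintro d ⟨hdC, hda, hdB, c, hc, hdc⟩ b hb b' hb' hbb
    by_contra! hn
    exact hF a b b' c d hbb hb.2 hb'.2 hc.2 hdc.symm (hBB _ hb _ hb') (hBB _ hb _ hc)
      (hBB _ hb' _ hc) (fun h => hdB ⟨hdC, h.symm⟩) hn.1 hn.2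
  have hD2 : ∀ d ∈ D, ∃ b ∈ B, ∃ b' ∈ B, b ≠ b' ∧ G.Adj d b ∧ G.Adj d b' := by
    intro d hd
    have e1 := hD d hd b₁ ⟨h1, a1⟩ b₂ ⟨h2, a2⟩ h12
    have e2 := hD d hd b₁ ⟨h1, a1⟩ b₃ ⟨h3, a3⟩ h13
    have e3 := hD d hd b₂ ⟨h2, a2⟩ b₃ ⟨h3, a3⟩ h23
    by_cases f1 : G.Adj d b₁
    · rcases e3 with h | h
      · exact ⟨b₁, ⟨h1, a1⟩, b₂, ⟨h2, a2⟩, h12, f1, h⟩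
      · exact ⟨b₁, ⟨h1, a1⟩, b₃, ⟨h3, a3⟩, h13, f1, h⟩
    · exact ⟨b₂, ⟨h2, a2⟩, b₃, ⟨h3, a3⟩, h23, e1.resolve_left f1, e2.resolve_left f1⟩
  have hDD : ∀ d ∈ D, ∀ d' ∈ D, ¬ G.Adj d d' := by
    intro d hd d' hd' hdd
    obtain ⟨b, hb, b', hb', hbb, e1, e2⟩ := hD2 d hd
    rcases hD d' hd' b hb b' hb' hbb with h | h
    · exact hT d hd.1 d' hd'.1 b hb.1 hdd h e1
    · exact hT d hd.1 d' hd'.1 b' hb'.1 hdd h e2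
  have hE : ∀ e ∈ E, ∀ f ∈ C, G.Adj e f → f ∈ D := by
    rintro e ⟨heC, hea, heB, heD, d, hd, hed⟩ f hf hef
    by_contra hfD
    obtain ⟨b, hb, b', hb', hbb, e1, e2⟩ := hD2 d hd
    have heb : ∀ c ∈ B, ¬ G.Adj e c := fun c hc h => heD ⟨heC, hea, heB, c, hc, h⟩
    have hfa : f ≠ a := by rintro rfl; exact heB ⟨heC, hef.symm⟩
    have hfB : f ∉ B := fun h => heb f h hef
    have hfb : ∀ c ∈ B, ¬ G.Adj f c := fun c hc h => hfD ⟨hf, hfa, hfB, c, hc, h⟩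
    exact hF d b b' e f hbb e1 e2 hed.symm hef (hBB _ hb _ hb') (fun h => heb b hb h.symm)
      (fun h => heb b' hb' h.symm) (fun h => hT e heC d hd.1 f hf hed h.symm hef)
      (hfb b hb) (hfb b' hb')
  have hcl : ∀ y ∈ C, y = a ∨ y ∈ B ∨ y ∈ D ∨ y ∈ E := by
    intro y hy
    refine hC (fun y => y = a ∨ y ∈ B ∨ y ∈ D ∨ y ∈ E) ?_ a ha y hy (Or.inl rfl)
    rintro x hx y hy hxy (rfl | hxB | hxD | hxE)
    · exact Or.inr (Or.inl ⟨hy, hxy⟩)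
    · by_cases hya : y = a
      · exact Or.inl hya
      · exact Or.inr (Or.inr (Or.inl ⟨hy, hya, fun h => hBB _ hxB _ h hxy, x, hxB, hxy.symm⟩))
    · by_cases hya : y = a
      · exact Or.inl hya
      by_cases hyB : y ∈ B
      · exact Or.inr (Or.inl hyB)
      exact Or.inr (Or.inr (Or.inr ⟨hy, hya, hyB, fun h => hDD _ hxD _ h hxy, x, hxD, hxy.symm⟩))
    · exact Or.inr (Or.inr (Or.inl (hE x hxE y hy hxy)))
  refine ⟨fun x => decide (x = a ∨ x ∈ D), ?_⟩
  intro x hx y hy hxy he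
  have he' : (x = a ∨ x ∈ D) ↔ (y = a ∨ y ∈ D) := decide_eq_decide.1 he
  by_cases hxc : x = a ∨ x ∈ D
  · rcases hxc with rfl | hxD
    · rcases he'.1 (Or.inl rfl) with rfl | hyD
      · exact hxy.ne rfl
      · exact hyD.2.2.1 ⟨hy, hxy⟩
    · rcases he'.1 (Or.inr hxD) with rfl | hyD
      · exact hxD.2.2.1 ⟨hx, hxy.symm⟩
      · exact hDD _ hxD _ hyD hxy
  · have hyc : ¬ (y = a ∨ y ∈ D) := fun h => hxc (he'.2 h)
    push Not at hxc hyc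
    have hx' := ((hcl x hx).resolve_left hxc.1)
    have hy' := ((hcl y hy).resolve_left hyc.1)
    rcases hx' with hxB | hxD | hxE
    · rcases hy' with hyB | hyD | hyE
      · exact hBB _ hxB _ hyB hxy
      · exact hyc.2 hyD
      · exact hxc.2 (hE y hyE x hx hxy.symm)
    · exact hxc.2 hxD
    · exact hyc.2 (hE x hxE y hy hxy)

/-- `O` induces an odd cycle which is a connected component of the subgraph induced on `M`. -/
structure IsOddHole (G : SimpleGraph V) (M O : Set V) : Prop where
  sub : O ⊆ M
  not_bipartiteOn : ¬ BipartiteOn G O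
  conn : ConnectedOn G O
  exists_two : ∀ x ∈ O, ∃ y ∈ O, ∃ z ∈ O, y ≠ z ∧ G.Adj x y ∧ G.Adj x z
  eq_or_eq : ∀ x ∈ O, ∀ y ∈ O, ∀ z ∈ O, G.Adj x y → G.Adj x z → y ≠ z →
    ∀ u ∈ M, G.Adj x u → u = y ∨ u = z

/-- An inclusion-minimal non-bipartite `O` works. A vertex with at most one neighbour in `O` could
be coloured last. A further neighbour `u` in `M` of a vertex with two neighbours in `O` would give
that vertex degree three in the connected set `insert u O`, making it bipartite. -/
theorem exists_isOddHole [Finite V] (hF : ForkFree G) {M : Set V} (hT : TriangleFreeOn G M)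
    (hM : ¬ BipartiteOn G M) : ∃ O, IsOddHole G M O := by
  classical
  obtain ⟨O, hOM, hO⟩ := exists_minimal_le_of_wellFoundedLT (fun O => ¬ BipartiteOn G O) M hM
  have hmin : ∀ X ⊆ O, X ≠ O → BipartiteOn G X := by
    intro X hX hne
    by_contra h
    exact hne (hX.antisymm (hO.2 h hX))
  have hconn : ConnectedOn G O := by
    intro p hp x hx y hy hpx
    by_contra hpy
    obtain ⟨f, hf⟩ := hmin {z ∈ O | p z} (Set.sep_subset _ _) (fun h => hpy (h.ge hy).2)
    obtain ⟨g, hg⟩ := hmin {z ∈ O | ¬ p z} (Set.sep_subset _ _) (fun h => (h.ge hx).2 hpx)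
    refine hO.1 ⟨fun z => if p z then f z else g z, ?_⟩
    intro a ha b hb hab
    by_cases hpa : p a
    · have hpb := hp a ha b hb hab hpa
      simpa [hpa, hpb] using hf a ⟨ha, hpa⟩ b ⟨hb, hpb⟩ hab
    · have hpb : ¬ p b := fun h => hpa (hp b hb a ha hab.symm h)
      simpa [hpa, hpb] using hg a ⟨ha, hpa⟩ b ⟨hb, hpb⟩ hab
  refine ⟨O, hOM, hO.1, hconn, ?_, ?_⟩
  · intro x hx
    by_contra! hn
    obtain ⟨f, hf⟩ := hmin (O \ {x}) Set.sdiff_subset (fun h => (h.ge hx).2 rfl)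
    obtain ⟨c, hc⟩ : ∃ c : Bool, ∀ y ∈ O, G.Adj x y → f y ≠ c := by
      by_cases h : ∃ y ∈ O, G.Adj x y
      · obtain ⟨y, hy, hxy⟩ := h
        refine ⟨!f y, fun z hz hxz => ?_⟩
        by_cases hyz : y = z
        · subst hyz; simp
        · exact absurd hxz (hn y hy z hz hyz hxy)
      · push Not at h
        exact ⟨true, fun y hy hxy => absurd hxy (h y hy)⟩
    refine hO.1 ⟨Function.update f x c, ?_⟩
    intro a ha b hb hab
    by_cases hax : a = x
    · subst hax
      simpa [Function.update_of_ne hab.ne'] using (hc b hb hab).symm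
    · by_cases hbx : b = x
      · subst hbx
        simpa [Function.update_of_ne hax] using hc a ha hab.symm
      · simpa [Function.update_of_ne hax, Function.update_of_ne hbx] using
          hf a ⟨ha, hax⟩ b ⟨hb, hbx⟩ hab
  · intro x hx y hy z hz hxy hxz hyz u hu hxu
    by_contra! hne
    have hsub : insert u O ⊆ M := Set.insert_subset hu hOM
    have hconn' : ConnectedOn G (insert u O) := by
      intro p hp
      have hO' := hconn p (fun a ha b hb => hp a (Or.inr ha) b (Or.inr hb))
      rintro a (rfl | ha) b (rfl | hb) hpa
      · exact hpa
      · exact hO' x hx b hb (hp a (Or.inl rfl) x (Or.inr hx) hxu.symm hpa)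
      · exact hp x (Or.inr hx) b (Or.inl rfl) hxu (hO' a ha x hx hpa)
      · exact hO' a ha b hb hpa
    refine hO.1 ((bipartiteOn_of_three_nbrs hF hconn' ?_ (Or.inr hx) (Or.inr hy) (Or.inr hz)
      (Or.inl rfl) hxy hxz hxu hyz hne.1.symm hne.2.symm).mono (Set.subset_insert u O))
    exact fun a ha b hb c hc => hT a (hsub ha) b (hsub hb) c (hsub hc)

/-! ### Attachments to an odd hole -/

namespace IsOddHole

variable {M O : Set V}

theorem other (hO : IsOddHole G M O) {x y : V} (hx : x ∈ O) (hy : y ∈ O) (hxy : G.Adj x y) :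
    ∃ z ∈ O, z ≠ y ∧ G.Adj x z ∧ ∀ u ∈ M, G.Adj x u → u = y ∨ u = z := by
  obtain ⟨a, ha, b, hb, hab, hxa, hxb⟩ := hO.exists_two x hx
  by_cases hya : y = a
  · subst hya
    exact ⟨b, hb, hab.symm, hxb, hO.eq_or_eq x hx y hy b hb hxy hxb hab⟩
  · exact ⟨a, ha, fun h => hya h.symm, hxa, hO.eq_or_eq x hx y hy a ha hxy hxa hya⟩

/-- All neighbours of the four vertices are already among them, so by connectivity `O` would be this
even cycle, which is bipartite. -/
theorem no_four_cycle (hO : IsOddHole G M O) {a b c d : V} (ha : a ∈ O) (hb : b ∈ O) (hc : c ∈ O)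
    (hd : d ∈ O) (hab : G.Adj a b) (hbc : G.Adj b c) (hcd : G.Adj c d) (hda : G.Adj d a)
    (hac : a ≠ c) (hbd : b ≠ d) : False := by
  classical
  have na := hO.eq_or_eq a ha b hb d hd hab hda.symm hbd
  have nb := hO.eq_or_eq b hb a ha c hc hab.symm hbc hac
  have nc := hO.eq_or_eq c hc b hb d hd hbc.symm hcd hbd
  have nd := hO.eq_or_eq d hd a ha c hc hda hcd.symm hac
  have hall : ∀ y ∈ O, y = a ∨ y = b ∨ y = c ∨ y = d := by
    intro y hy
    refine hO.conn (fun y => y = a ∨ y = b ∨ y = c ∨ y = d) ?_ a ha y hy (Or.inl rfl)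
    rintro x hx y hy hxy (rfl | rfl | rfl | rfl)
    · rcases na y (hO.sub hy) hxy with rfl | rfl <;> simp
    · rcases nb y (hO.sub hy) hxy with rfl | rfl <;> simp
    · rcases nc y (hO.sub hy) hxy with rfl | rfl <;> simp
    · rcases nd y (hO.sub hy) hxy with rfl | rfl <;> simp
  refine hO.not_bipartiteOn ⟨fun x => decide (x = a ∨ x = c), ?_⟩
  intro x hx y hy hxy he
  have he' : (x = a ∨ x = c) ↔ (y = a ∨ y = c) := decide_eq_decide.1 he
  have hM := hO.sub hy
  rcases hall x hx with rfl | rfl | rfl | rfl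
  · have := na y hM hxy
    grind [hab.ne, hbc.ne, hcd.ne, hda.ne]
  · have := nb y hM hxy
    grind [hab.ne, hbc.ne, hcd.ne, hda.ne]
  · have := nc y hM hxy
    grind [hab.ne, hbc.ne, hcd.ne, hda.ne]
  · have := nd y hM hxy
    grind [hab.ne, hbc.ne, hcd.ne, hda.ne]

/-- A neighbour `w` of `v` which is mixed on an odd hole of the non-neighbourhood of `v` is adjacent
to exactly two vertices of it, and these are adjacent. -/
theorem mixed_nbr (hO : IsOddHole G M O) (hF : ForkFree G) (hT : TriangleFreeOn G M) {v w p q : V}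
    (hv : ∀ x ∈ M, ¬ G.Adj v x) (hvw : G.Adj v w) (hp : p ∈ O) (hq : q ∈ O) (hpq : G.Adj p q)
    (hwp : G.Adj w p) (hwq : ¬ G.Adj w q) :
    ∃ p' ∈ O, ∃ q' ∈ O, ∃ r ∈ O, G.Adj p p' ∧ G.Adj w p' ∧ G.Adj p' q' ∧ ¬ G.Adj w q' ∧
      G.Adj q r ∧ ¬ G.Adj w r ∧ ¬ G.Adj p r ∧ ¬ G.Adj p' r ∧ ¬ G.Adj q p' ∧ q ≠ p' ∧
      ∀ z ∈ O, G.Adj w z → z = p ∨ z = p' := by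
  have tri : ∀ {x y z}, x ∈ O → y ∈ O → z ∈ O → G.Adj x y → G.Adj y z → ¬ G.Adj x z :=
    fun hx hy hz h1 h2 h3 => hT _ (hO.sub hx) _ (hO.sub hy) _ (hO.sub hz) h1 h2 h3
  have hvO : ∀ {x}, x ∈ O → ¬ G.Adj v x := fun hx => hv _ (hO.sub hx)
  -- Around the edge `p q` the hole reads `r, q, p, p', q'`.
  obtain ⟨p', hp', hp'q, hpp', np⟩ := hO.other hp hq hpq
  have hqp' : ¬ G.Adj q p' := tri hq hp hp' hpq.symm hpp'
  have hwp' : G.Adj w p' := by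
    by_contra hn
    exact hF p q p' w v hp'q.symm hpq hpp' hwp.symm hvw.symm hqp' (fun h => hwq h.symm)
      (fun h => hn h.symm) (hvO hp) (hvO hq) (hvO hp')
  obtain ⟨q', hq', hq'p, hp'q', np'⟩ := hO.other hp' hp hpp'.symm
  have hqq' : q' ≠ q := by rintro rfl; exact hqp' hp'q'.symm
  have hc4 : ¬ G.Adj q q' := fun h =>
    hO.no_four_cycle hp hp' hq' hq hpp' hp'q' h.symm hpq.symm hq'p.symm hp'q
  -- a neighbour of `w` is adjacent to `p` or `q`
  have dom : ∀ {x y z}, x ∈ O → y ∈ O → z ∈ O → G.Adj x y → G.Adj w x → ¬ G.Adj w y → G.Adj w z →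
      z ≠ x → G.Adj z x ∨ G.Adj z y := by
    intro x y z hx hy hz hxy hwx hwy hwz hzx
    by_contra! hn
    have hvz : v ≠ z := by
      rintro rfl
      obtain ⟨a, ha, -, -, -, hva, -⟩ := hO.exists_two v hz
      exact hvO ha hva
    exact hF w v z x y hvz hvw.symm hwz hwx hxy (hvO hz) (hvO hx) hn.1
      (fun h => hwy h.symm) (fun h => hvO hy h.symm) (fun h => hn.2 h.symm)
  have hwq' : ¬ G.Adj w q' := by
    intro h
    rcases dom hp hq hq' hpq hwp hwq h hq'p with h' | h'
    · exact tri hq' hp' hp hp'q'.symm hpp'.symm h'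
    · exact hc4 h'.symm
  -- By domination at both boundary edges, a third neighbour `z` of `w` is adjacent to `q` and `q'`;
  -- these leaves and the path `z - w - v` form a fork.
  have two : ∀ z ∈ O, G.Adj w z → z = p ∨ z = p' := by
    intro z hz hwz
    by_contra! hn
    have hzq : G.Adj z q := by
      rcases dom hp hq hz hpq hwp hwq hwz hn.1 with h | h
      · rcases np z (hO.sub hz) h.symm with rfl | rfl
        · exact absurd hwz hwq
        · exact absurd rfl hn.2
      · exact h
    have hzq' : G.Adj z q' := by
      rcases dom hp' hq' hz hp'q' hwp' hwq' hwz hn.2 with h | h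
      · rcases np' z (hO.sub hz) h.symm with rfl | rfl
        · exact absurd rfl hn.1
        · exact absurd hwz hwq'
      · exact h
    exact hF z q q' w v hqq'.symm hzq hzq' hwz.symm hvw.symm hc4 (fun h => hwq h.symm)
      (fun h => hwq' h.symm) (hvO hz) (hvO hq) (hvO hq')
  obtain ⟨r, hr, hrp, hqr, -⟩ := hO.other hq hp hpq.symm
  have hrp' : r ≠ p' := by rintro rfl; exact hqp' hqr
  refine ⟨p', hp', q', hq', r, hr, hpp', hwp', hp'q', hwq', hqr, ?_, ?_, ?_, hqp', hp'q.symm, two⟩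
  · intro h
    rcases two r hr h with h | h
    · exact hrp h
    · exact hrp' h
  · exact tri hp hq hr hpq hqr
  · intro h
    rcases np' r (hO.sub hr) h with rfl | rfl
    · exact hrp rfl
    · exact hc4 hqr

end IsOddHole

/-- The vertices different from and not adjacent to `v`. -/
def nonNbrs (G : SimpleGraph V) (v : V) : Set V := {x | x ≠ v ∧ ¬ G.Adj v x}

theorem isClawAt_compl {v x y z : V} (hx : x ∈ nonNbrs G v) (hy : y ∈ nonNbrs G v)
    (hz : z ∈ nonNbrs G v) (hxy : G.Adj x y) (hyz : G.Adj y z) (hxz : G.Adj x z) :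
    IsClawAt Gᶜ v ![x, y, z] := by
  constructor
  · intro i j hij
    fin_cases i <;> fin_cases j <;>
      simp_all [hxy.ne, hxy.ne', hyz.ne, hyz.ne', hxz.ne, hxz.ne']
  · intro i
    fin_cases i
    exacts [⟨hx.1.symm, hx.2⟩, ⟨hy.1.symm, hy.2⟩, ⟨hz.1.symm, hz.2⟩]
  · intro i j
    fin_cases i <;> fin_cases j <;>
      simp [hxy, hxy.symm, hyz, hyz.symm, hxz, hxz.symm]

theorem triangleFreeOn_nonNbrs {v : V} (h : ∀ t, ¬ IsClawAt Gᶜ v t) :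
    TriangleFreeOn G (nonNbrs G v) :=
  fun _ hx _ hy _ hz hxy hyz hxz => h _ (isClawAt_compl hx hy hz hxy hyz hxz)

namespace IsOddHole

variable {O : Set V} {v : V}

theorem exists_boundary {M : Set V} (hO : IsOddHole G M O) {w x y : V} (hx : x ∈ O) (hy : y ∈ O)
    (hwx : G.Adj w x) (hwy : ¬ G.Adj w y) : ∃ p ∈ O, ∃ q ∈ O, G.Adj p q ∧ G.Adj w p ∧ ¬ G.Adj w q := by
  by_contra! hn
  exact hwy (hO.conn (fun z => G.Adj w z) hn x hx y hy hwx)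

theorem closed {M : Set V} (hO : IsOddHole G M O) {x u : V} (hx : x ∈ O) (hu : u ∈ M)
    (hxu : G.Adj x u) : u ∈ O := by
  obtain ⟨y, hy, z, hz, hyz, hxy, hxz⟩ := hO.exists_two x hx
  rcases hO.eq_or_eq x hx y hy z hz hxy hxz hyz u hu hxu with rfl | rfl <;> assumption

/-- In a prime graph some neighbour of `v` is mixed on an odd hole in the non-neighbourhood. -/
theorem exists_mixed (hO : IsOddHole G (nonNbrs G v) O) (hP : IsPrime G) (hne : O.Nonempty) :
    ∃ w, G.Adj v w ∧ ∃ p ∈ O, ∃ q ∈ O, G.Adj p q ∧ G.Adj w p ∧ ¬ G.Adj w q := by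
  by_contra! hn
  have hvO : v ∉ O := fun h => (hO.sub h).1 rfl
  obtain ⟨x, hx⟩ := hne
  obtain ⟨y, hy, -, -, -, hxy, -⟩ := hO.exists_two x hx
  refine hxy.ne (hP O ?_ (fun h => hvO (h ▸ Set.mem_univ v)) hx hy)
  intro u hu a ha b hb hua
  by_contra hub
  obtain ⟨p, hp, q, hq, hpq, hup, huq⟩ := hO.exists_boundary ha hb hua hub
  by_cases hvu : G.Adj v u
  · exact huq (hn u hvu p hp q hq hpq hup)
  · by_cases huv : u = v
    · exact (hO.sub hp).2 (huv ▸ hup)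
    · exact hu (hO.closed hp ⟨huv, hvu⟩ hup.symm)

theorem nonempty {M : Set V} (hO : IsOddHole G M O) : O.Nonempty := by
  by_contra h
  rw [Set.not_nonempty_iff_eq_empty] at h
  exact hO.not_bipartiteOn ⟨fun _ => true, by simp [h]⟩

/-- The neighbours of a mixed vertex in an odd hole form an edge. -/
theorem mixed_nbrs_edge {M : Set V} (hO : IsOddHole G M O) (hF : ForkFree G) (hT : TriangleFreeOn G M)
    (hv : ∀ x ∈ M, ¬ G.Adj v x) {w x₀ y₀ : V} (hvw : G.Adj v w) (hx₀ : x₀ ∈ O) (hy₀ : y₀ ∈ O)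
    (hwx : G.Adj w x₀) (hwy : ¬ G.Adj w y₀) :
    (∀ x ∈ O, ∀ y ∈ O, G.Adj w x → G.Adj w y → x ≠ y → G.Adj x y) ∧
      ∀ x ∈ O, ∀ y ∈ O, ∀ z ∈ O, G.Adj w x → G.Adj w y → G.Adj w z → x = y ∨ x = z ∨ y = z := by
  obtain ⟨p, hp, q, hq, hpq, hwp, hwq⟩ := hO.exists_boundary hx₀ hy₀ hwx hwy
  obtain ⟨p', hp', q', hq', r, hr, hpp', -, -, -, -, -, -, -, -, -, two⟩ :=
    hO.mixed_nbr hF hT hv hvw hp hq hpq hwp hwq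
  constructor
  · intro x hx y hy h1 h2 hxy
    rcases two x hx h1 with rfl | rfl <;> rcases two y hy h2 with rfl | rfl
    exacts [absurd rfl hxy, hpp', hpp'.symm, absurd rfl hxy]
  · intro x hx y hy z hz h1 h2 h3
    have := two x hx h1
    have := two y hy h2
    have := two z hz h3
    grind

end IsOddHole

/-! ### Bipartite non-neighbourhoods in prime graphs -/

/-- In a prime fork-free graph without triangles in non-neighbourhoods, non-neighbourhoods are
bipartite. -/
theorem bipartiteOn_nonNbrs_of_no_compl_claw [Finite V] (hF : ForkFree G) (hP : IsPrime G)
    (hno : ∀ u t, ¬ IsClawAt Gᶜ u t) (v : V) : BipartiteOn G (nonNbrs G v) := by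
  by_contra hb
  have hT := triangleFreeOn_nonNbrs (hno v)
  obtain ⟨O, hO⟩ := exists_isOddHole hF hT hb
  obtain ⟨w, hvw, p, hp, q, hq, hpq, hwp, hwq⟩ := hO.exists_mixed hP hO.nonempty
  obtain ⟨p', hp', q', hq', r, hr, hpp', hwp', hpq', hwq', hqr, hwr, hpr, hpr', -, -, -⟩ :=
    hO.mixed_nbr hF hT (fun x hx => hx.2) hvw hp hq hpq hwp hwq
  have hrw : r ≠ w := by rintro rfl; exact (hO.sub hr).2 hvw
  have hrp : r ≠ p := by rintro rfl; exact hwr hwp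
  have hrp' : r ≠ p' := by rintro rfl; exact hwr hwp'
  -- The triangle `w, p, p'` lies in the non-neighbourhood of the hole vertex `r`, not of `v`.
  exact hno r _ (isClawAt_compl (v := r) (x := w) (y := p) (z := p')
    ⟨hrw.symm, fun h => hwr h.symm⟩ ⟨hrp.symm, fun h => hpr h.symm⟩
    ⟨hrp'.symm, fun h => hpr' h.symm⟩ hwp hpp' hwp')

theorem exists_third (i j : Fin 3) : ∃ k, k ≠ i ∧ k ≠ j := by
  revert i j; decide

/-- In a prime uncluttered graph, the non-neighbourhood of a claw centre is bipartite. -/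
theorem IsClawAt.bipartiteOn_nonNbrs [Finite V] (hG : Uncluttered G) (hP : IsPrime G) {v : V}
    {s : Fin 3 → V} (hs : IsClawAt G v s) : BipartiteOn G (nonNbrs G v) := by
  by_contra hb
  have hF := hG.forkFree
  have hK := hG.kiteFree
  have hT := triangleFreeOn_nonNbrs (fun t ht => hs.false_of_compl hG hP ht)
  obtain ⟨O, hO⟩ := exists_isOddHole hF hT hb
  have hvO : ∀ {x}, x ∈ O → ¬ G.Adj v x := fun hx => (hO.sub hx).2
  have hOv : ∀ {x}, x ∈ O → ¬ G.Adj x v := fun hx h => (hO.sub hx).2 h.symm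
  have hM : ∀ x ∈ nonNbrs G v, ¬ G.Adj v x := fun x hx => hx.2
  obtain ⟨w₀, hvw₀, p, hp, q, hq, hpq, hwp, hwq⟩ := hO.exists_mixed hP hO.nonempty
  obtain ⟨p', hp', -, -, r, hr, hpp', hwp', -, -, hqr, hwr, hpr, hpr', -, -, -⟩ :=
    hO.mixed_nbr hF hT hM hvw₀ hp hq hpq hwp hwq
  have hpr_ne : p ≠ r := by rintro rfl; exact hwr hwp
  -- complete neighbours are adjacent to mixed ones and to anticomplete ones
  have mixed_complete : ∀ {w k x y}, G.Adj v w → x ∈ O → y ∈ O → G.Adj w x → ¬ G.Adj w y →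
      (∀ z ∈ O, G.Adj k z) → G.Adj w k := by
    intro w k x y hvw hx hy hwx hwy hk
    by_contra hwk
    obtain ⟨p, hp, q, hq, hpq, hwp, hwq⟩ := hO.exists_boundary hx hy hwx hwy
    obtain ⟨p', hp', -, -, r, hr, hpp', hwp', -, -, hqr, hwr, hpr, hpr', -, -, -⟩ :=
      hO.mixed_nbr hF hT hM hvw hp hq hpq hwp hwq
    have hkw : k ≠ w := by rintro rfl; exact hwy (hk y hy)
    exact hK p p' k w r hpp' (hk p hp) (hk p' hp') hwp hwp' (hk r hr).symm hkw
      (fun h => hwk h.symm) (fun h => hpr h.symm) (fun h => hpr' h.symm) (fun h => hwr h.symm)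
  have anti_complete : ∀ {l k}, G.Adj v l → G.Adj v k → (∀ z ∈ O, ¬ G.Adj l z) →
      (∀ z ∈ O, G.Adj k z) → G.Adj l k := by
    intro l k hvl hvk hl hk
    by_contra hlk
    exact hF k p r v l hpr_ne (hk p hp) (hk r hr) hvk.symm hvl hpr (hOv hp) (hOv hr) hlk
      (hl p hp) (hl r hr)
  have not_mixed : ∀ i x y, x ∈ O → y ∈ O → G.Adj (s i) x → G.Adj (s i) y := by
    intro i x y hx hy hix
    by_contra hiy
    have hncomp : ∀ j, ∃ z ∈ O, ¬ G.Adj (s j) z := by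
      intro j
      by_contra! hn
      exact hs.indep i j (mixed_complete (hs.adj i) hx hy hix hiy hn)
    obtain ⟨p, hp, q, hq, hpq, hip, hiq⟩ := hO.exists_boundary hx hy hix hiy
    obtain ⟨p', hp', -, -, r, hr, hpp', hip', -, -, hqr, hir, hpr, hpr', hqp', hqp'_ne, -⟩ :=
      hO.mixed_nbr hF hT hM (hs.adj i) hp hq hpq hip hiq
    have hrp : r ≠ p := by rintro rfl; exact hir hip
    have hrp' : r ≠ p' := by rintro rfl; exact hir hip'
    -- A second leaf `s j` at `p` is also mixed, so it sees just one hole edge, `p q` or `p p'`. In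
    -- the first case the third leaf must see the nonadjacent `q` and `p'`; in the second, `s i`, `s
    -- j` and the path `p - q - r` form a fork.
    obtain ⟨j, hji, hpj⟩ : ∃ j, j ≠ i ∧ G.Adj p (s j) := by
      obtain ⟨j, k, hj, hk, hjk⟩ := exists_others i
      rcases hs.adj_or_adj hF (hOv hp) hip.symm hjk with h | h
      exacts [⟨j, hj, h⟩, ⟨k, hk, h⟩]
    obtain ⟨z, hz, hjz⟩ := hncomp j
    have hj2 := hO.mixed_nbrs_edge hF hT hM (hs.adj j) hp hz hpj.symm hjz
    by_cases hjq : G.Adj (s j) q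
    · have hjp' : ¬ G.Adj (s j) p' := by
        intro h
        rcases hj2.2 p hp q hq p' hp' hpj.symm hjq h with h | h | h
        exacts [hpq.ne h, hpp'.ne h, hqp'_ne h]
      obtain ⟨k, hki, hkj⟩ := exists_third i j
      have hkp' : G.Adj p' (s k) :=
        (hs.adj_or_adj hF (hOv hp') hip'.symm hkj).resolve_right (fun h => hjp' h.symm)
      have hkq : G.Adj q (s k) :=
        (hs.adj_or_adj hF (hOv hq) hjq.symm hki).resolve_right (fun h => hiq h.symm)
      obtain ⟨z, hz, hkz⟩ := hncomp k
      exact hqp' ((hO.mixed_nbrs_edge hF hT hM (hs.adj k) hq hz hkq.symm hkz).1 q hq p' hp'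
        hkq.symm hkp'.symm hqp'_ne)
    · have hjp' : G.Adj (s j) p' := by
        obtain ⟨a, ha, -, -, -, -, hpa, hja, -⟩ :=
          hO.mixed_nbr hF hT hM (hs.adj j) hp hq hpq hpj.symm hjq
        rcases hO.eq_or_eq p hp q hq p' hp' hpq hpp' hqp'_ne a (hO.sub ha) hpa with rfl | rfl
        exacts [absurd hja hjq, hja]
      have hjr : ¬ G.Adj (s j) r := by
        intro h
        rcases hj2.2 p hp p' hp' r hr hpj.symm hjp' h with h | h | h
        exacts [hpp'.ne h, hrp h.symm, hrp' h.symm]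
      exact hF p (s i) (s j) q r (hs.inj _ _ hji.symm) hip.symm hpj hpq hqr (hs.indep _ _) hiq hjq
        (fun h => hpr h.symm) (fun h => hir h.symm) (fun h => hjr h.symm)
  -- If every leaf were anticomplete to `O`, the mixed vertex `w₀` would distinguish a hole edge
  -- anticomplete to the claw.
  have complete_one : ∃ k, ∀ z ∈ O, G.Adj (s k) z := by
    by_contra! hn
    have hanti : ∀ k, ∀ x ∈ O, ¬ G.Adj x (s k) := by
      intro k x hx h
      obtain ⟨z, hz, hkz⟩ := hn k
      exact hkz (not_mixed k x z hx hz h.symm)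
    exact hs.not_distinguish hF hpq hwp hwq (hvO hp) (fun i => hanti i p hp)
      (fun i => hanti i q hq) (Or.inl hvw₀.symm)
  obtain ⟨k, hk⟩ := complete_one
  have complete_all : ∀ i, ∀ z ∈ O, G.Adj (s i) z := by
    intro i z hz
    by_contra hiz
    exact hs.indep i k (anti_complete (hs.adj i) (hs.adj k)
      (fun x hx h => hiz (not_mixed i x z hx hz h)) hk)
  -- The component `A` of `K` in the complement contains two leaves and is a module. Neighbours of
  -- `v` outside `K` are complete to `A` by the facts above; a non-neighbour outside `O`
  -- distinguishing a non-edge of `A` gives an antifork with the hole edge `p p'`.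
  let K : Set V := {k | G.Adj v k ∧ ∀ z ∈ O, G.Adj k z}
  obtain ⟨A, hAK, h0A, hclosed, hconn⟩ :=
    exists_component Gᶜ (U := K) (t := s 0) ⟨hs.adj 0, complete_all 0⟩
  have h01 : s 0 ≠ s 1 := hs.inj 0 1 (by decide)
  have h1A : s 1 ∈ A := hclosed _ h0A _ ⟨hs.adj 1, complete_all 1⟩
    ((SimpleGraph.compl_adj _ _ _).2 ⟨h01, hs.indep 0 1⟩)
  have hvA : v ∉ A := fun h => (hAK h).1.ne rfl
  refine h01 (hP A ?_ (fun h => hvA (h ▸ Set.mem_univ v)) h0A h1A)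
  intro u hu x hx y hy hux
  refine hconn (fun z => G.Adj u z) ?_ x hx y hy hux
  intro x hx y hy hxy hux
  rw [SimpleGraph.compl_adj] at hxy
  by_contra huy
  have huy_ne : u ≠ y := by rintro rfl; exact hu hy
  by_cases huK : u ∈ K
  · exact hu (hclosed y hy u huK ((SimpleGraph.compl_adj _ _ _).2 ⟨huy_ne.symm, fun h => huy h.symm⟩))
  by_cases hvu : G.Adj v u
  · by_cases h : ∃ z ∈ O, G.Adj u z
    · obtain ⟨a, ha, hua⟩ := h
      obtain ⟨b, hb, hub⟩ : ∃ b ∈ O, ¬ G.Adj u b := by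
        by_contra! hn
        exact huK ⟨hvu, hn⟩
      exact huy (mixed_complete hvu ha hb hua hub (hAK hy).2)
    · push Not at h
      exact huy (anti_complete hvu (hAK hy).1 h (hAK hy).2)
  · by_cases huv : u = v
    · exact huy (huv ▸ (hAK hy).1)
    · by_cases huO : u ∈ O
      · exact huy ((hAK hy).2 u huO).symm
      · have hnO : ∀ z ∈ O, ¬ G.Adj u z := fun z hz h => huO (hO.closed hz ⟨huv, hvu⟩ h.symm)
        exact hK p p' x y u hpp' ((hAK hx).2 p hp) ((hAK hx).2 p' hp') ((hAK hy).2 p hp)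
          ((hAK hy).2 p' hp') hux hxy.1 hxy.2 (hnO p hp) (hnO p' hp') huy

/-! ### Colouring constraints on a minimal counterexample -/

/-- The subgraph induced on `s` has a proper colouring with `k` colours. -/
def ColorableOn (G : SimpleGraph V) (s : Set V) (k : ℕ) : Prop :=
  ∃ f : V → ℕ, (∀ x ∈ s, f x < k) ∧ ∀ x ∈ s, ∀ y ∈ s, G.Adj x y → f x ≠ f y

/-- All cliques contained in `s` have at most `m` vertices. -/
def CliquesLE (G : SimpleGraph V) (s : Set V) (m : ℕ) : Prop :=
  ∀ t : Finset V, (t : Set V) ⊆ s → G.IsClique (t : Set V) → t.card ≤ m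

/-- `G` has clique number at most `m`, but no `2 * m`-colouring, while every proper induced subgraph
satisfies the colouring bound. -/
structure IsMinCounterexample (G : SimpleGraph V) (m : ℕ) : Prop where
  cliques : CliquesLE G Set.univ m
  not_colorable : ¬ ColorableOn G Set.univ (2 * m)
  ih : ∀ s : Set V, s ≠ Set.univ → ∀ k, CliquesLE G s k → ColorableOn G s (2 * k)

theorem CliquesLE.mono {s t : Set V} {m : ℕ} (h : CliquesLE G t m) (hst : s ⊆ t) :
    CliquesLE G s m := fun c hc => h c (hc.trans hst)

theorem exists_max_clique [Finite V] (G : SimpleGraph V) (s : Set V) :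
    ∃ t : Finset V, (t : Set V) ⊆ s ∧ G.IsClique (t : Set V) ∧ CliquesLE G s t.card := by
  have hfin : {t : Finset V | (t : Set V) ⊆ s ∧ G.IsClique (t : Set V)}.Finite := Set.toFinite _
  obtain ⟨t, ht, hmax⟩ := Set.exists_max_image _ Finset.card hfin ⟨∅, by simp⟩
  exact ⟨t, ht.1, ht.2, fun c hc hc' => hmax c ⟨hc, hc'⟩⟩

namespace IsMinCounterexample

variable {m : ℕ}

theorem pos (h : IsMinCounterexample G m) (v : V) : 0 < m := by
  have := h.cliques {v} (Set.subset_univ _) (by simp)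
  simp at this
  omega

/-- A minimal counterexample is connected. -/
theorem exists_adj_of_cut (h : IsMinCounterexample G m) {X : Set V} (hX : X.Nonempty)
    (hX' : X ≠ Set.univ) : ∃ x ∈ X, ∃ y ∉ X, G.Adj x y := by
  classical
  by_contra! hn
  obtain ⟨f, hf, hf'⟩ := h.ih X hX' m (h.cliques.mono (Set.subset_univ _))
  obtain ⟨g, hg, hg'⟩ := h.ih Xᶜ (fun e => hX.ne_empty (Set.compl_univ_iff.1 e)) m
    (h.cliques.mono (Set.subset_univ _))
  refine h.not_colorable ⟨fun x => if x ∈ X then f x else g x, ?_, ?_⟩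
  · intro x _
    by_cases hx : x ∈ X
    · simpa [hx] using hf x hx
    · simpa [hx] using hg x hx
  · intro x _ y _ hxy
    by_cases hx : x ∈ X <;> by_cases hy : y ∈ X
    · simpa [hx, hy] using hf' x hx y hy hxy
    · exact absurd hxy (hn x hx y hy)
    · exact absurd hxy.symm (hn y hy x hx)
    · simpa [hx, hy] using hg' x hx y hy hxy

/-- The complement of a minimal counterexample is connected. -/
theorem exists_not_adj_of_cut [Finite V] (h : IsMinCounterexample G m) {X : Set V}
    (hX : X.Nonempty) (hX' : X ≠ Set.univ) : ∃ x ∈ X, ∃ y ∉ X, ¬ G.Adj x y := by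
  classical
  by_contra! hn
  obtain ⟨s, hs, hsc, hs'⟩ := exists_max_clique G X
  obtain ⟨t, ht, htc, ht'⟩ := exists_max_clique G Xᶜ
  have hdisj : Disjoint s t := by
    rw [Finset.disjoint_left]
    exact fun x hx hx' => ht hx' (hs hx)
  have hcard : s.card + t.card ≤ m := by
    rw [← Finset.card_union_of_disjoint hdisj]
    refine h.cliques _ (Set.subset_univ _) ?_
    intro x hx y hy hxy
    simp only [Finset.coe_union, Set.mem_union] at hx hy
    rcases hx with hx | hx <;> rcases hy with hy | hy
    · exact hsc hx hy hxy
    · exact hn x (hs hx) y (ht hy)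
    · exact (hn y (hs hy) x (ht hx)).symm
    · exact htc hx hy hxy
  obtain ⟨f, hf, hf'⟩ := h.ih X hX' _ hs'
  obtain ⟨g, hg, hg'⟩ := h.ih Xᶜ (fun e => hX.ne_empty (Set.compl_univ_iff.1 e)) _ ht'
  -- The sides are completely joined, so their clique numbers add up to at most `m` and disjoint
  -- palettes fit into `2 * m` colours.
  refine h.not_colorable ⟨fun x => if x ∈ X then f x else 2 * s.card + g x, ?_, ?_⟩
  · intro x _
    by_cases hx : x ∈ X
    · have := hf x hx
      simp only [hx, if_true]
      omega
    · have := hg x hx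
      simp only [hx, if_false]
      omega
  · intro x _ y _ hxy
    by_cases hx : x ∈ X <;> by_cases hy : y ∈ X <;> simp only [hx, hy, if_true, if_false]
    · exact hf' x hx y hy hxy
    · have := hf x hx
      omega
    · have := hf y hy
      omega
    · have := hg' x hx y hy hxy
      omega

/-- In a minimal counterexample no neighbourhood is the union of two cliques. -/
theorem not_two_cliques [Finite V] (h : IsMinCounterexample G m) (v : V) (g : V → Bool)
    (hg : ∀ x y, G.Adj v x → G.Adj v y → x ≠ y → g x = g y → G.Adj x y) : False := by
  classical
  have := Fintype.ofFinite V
  have hcl : ∀ b : Bool, (Finset.univ.filter (fun x => G.Adj v x ∧ g x = b)).card + 1 ≤ m := by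
    intro b
    rw [← Finset.card_insert_of_notMem (a := v) (by simp)]
    refine h.cliques _ (Set.subset_univ _) ?_
    intro x hx y hy hxy
    simp only [Finset.coe_insert, Finset.coe_filter, Finset.mem_univ, true_and, Set.mem_insert_iff,
      Set.mem_ofPred_eq] at hx hy
    rcases hx with rfl | hx <;> rcases hy with rfl | hy
    · exact absurd rfl hxy
    · exact hy.1
    · exact hx.1.symm
    · exact hg x y hx.1 hy.1 hxy (hx.2.trans hy.2.symm)
  obtain ⟨f, hf, hf'⟩ := h.ih {v}ᶜ (by simp) m (h.cliques.mono (Set.subset_univ _))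
  -- Each clique together with `v` has at most `m` vertices, so at most `2 * (m - 1)` colours are
  -- forbidden.
  obtain ⟨c, hc, hc'⟩ : ∃ c ∈ Finset.range (2 * m),
      c ∉ (Finset.univ.filter (fun x => G.Adj v x ∧ g x = true) ∪
        Finset.univ.filter (fun x => G.Adj v x ∧ g x = false)).image f := by
    apply Finset.exists_mem_notMem_of_card_lt_card
    rw [Finset.card_range]
    have h1 := hcl true
    have h2 := hcl false
    refine lt_of_le_of_lt (Finset.card_image_le.trans (Finset.card_union_le _ _)) ?_
    omega
  have hcv : ∀ y, G.Adj v y → f y ≠ c := by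
    intro y hy hfy
    apply hc'
    rw [Finset.mem_image]
    refine ⟨y, ?_, hfy⟩
    cases hgy : g y <;> simp [hy, hgy]
  refine h.not_colorable ⟨Function.update f v c, ?_, ?_⟩
  · intro x _
    by_cases hx : x = v
    · subst hx; simpa using hc
    · simpa [Function.update_of_ne hx] using hf x hx
  · intro x _ y _ hxy
    by_cases hx : x = v
    · subst hx
      simpa [Function.update_of_ne hxy.ne'] using (hcv y hxy).symm
    · by_cases hy : y = v
      · subst hy
        simpa [Function.update_of_ne hx] using hcv x hxy.symm
      · simpa [Function.update_of_ne hx, Function.update_of_ne hy] using hf' x hx y hy hxy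

theorem not_clique_nbrs [Finite V] (h : IsMinCounterexample G m) (v : V) :
    ∃ x y, G.Adj v x ∧ G.Adj v y ∧ x ≠ y ∧ ¬ G.Adj x y := by
  by_contra! hn
  exact h.not_two_cliques v (fun _ => true) (fun x y hx hy hxy _ => hn x y hx hy hxy)

/-- In a minimal counterexample no non-neighbourhood is bipartite. -/
theorem not_bipartiteOn_nonNbrs (h : IsMinCounterexample G m) (v : V) :
    ¬ BipartiteOn G (nonNbrs G v) := by
  classical
  rintro ⟨f, hf⟩
  have hm := h.pos v
  have hcl : CliquesLE G {x | G.Adj v x} (m - 1) := by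
    intro t ht htc
    have hvt : v ∉ t := fun hv => (ht hv : G.Adj v v).ne rfl
    have := h.cliques (insert v t) (Set.subset_univ _) (by
      rw [Finset.coe_insert]
      exact htc.insert (fun b hb _ => ht hb))
    rw [Finset.card_insert_of_notMem hvt] at this
    omega
  obtain ⟨g, hg, hg'⟩ := h.ih _
    (fun e => G.loopless.irrefl v (e.ge (Set.mem_univ v))) _ hcl
  replace hg : ∀ x, G.Adj v x → g x < 2 * (m - 1) := hg
  replace hg' : ∀ x, G.Adj v x → ∀ y, G.Adj v y → G.Adj x y → g x ≠ g y := hg'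
  -- Two colours remain above those of the neighbours. Among the other vertices `v` is isolated, so
  -- it can share one of them.
  refine h.not_colorable ⟨fun x => if G.Adj v x then g x else
    if f x = true ∨ x = v then 2 * m - 2 else 2 * m - 1, ?_, ?_⟩
  · intro x _
    dsimp only
    split_ifs with h1 h2
    · have := hg x h1
      omega
    · omega
    · omega
  · intro x _ y _ hxy
    by_cases hx : G.Adj v x <;> by_cases hy : G.Adj v y <;> simp only [hx, hy, if_true, if_false]
    · exact hg' x hx y hy hxy
    · have := hg x hx
      split_ifs <;> omega
    · have := hg y hy
      split_ifs <;> omega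
    · have hxv : x ≠ v := by rintro rfl; exact hy hxy
      have hyv : y ≠ v := by rintro rfl; exact hx hxy.symm
      have := hf x ⟨hxv, hx⟩ y ⟨hyv, hy⟩ hxy
      cases hfx : f x <;> cases hfy : f y <;> simp_all <;> omega

/-- In a minimal counterexample no vertex is dominated by a nonadjacent one. -/
theorem not_dominated (h : IsMinCounterexample G m) {x y : V} (hxy : x ≠ y) (hn : ¬ G.Adj x y) :
    ∃ z, G.Adj x z ∧ ¬ G.Adj y z := by
  classical
  by_contra! hd
  obtain ⟨f, hf, hf'⟩ := h.ih {x}ᶜ (by simp) m (h.cliques.mono (Set.subset_univ _))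
  have key : ∀ z, G.Adj x z → f y ≠ f z := fun z hz =>
    hf' y hxy.symm z hz.ne' (hd z hz)
  -- Every neighbour of `x` is one of `y`, so `x` can take the colour of `y`.
  refine h.not_colorable ⟨Function.update f x (f y), ?_, ?_⟩
  · intro z _
    by_cases hz : z = x
    · subst hz; simpa using hf y hxy.symm
    · simpa [Function.update_of_ne hz] using hf z hz
  · intro a _ b _ hab
    by_cases ha : a = x
    · subst ha
      simpa [Function.update_of_ne hab.ne'] using key b hab
    · by_cases hb : b = x
      · subst hb
        simpa [Function.update_of_ne ha] using (key a hab.symm).symm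
      · simpa [Function.update_of_ne ha, Function.update_of_ne hb] using hf' a ha b hb hab

end IsMinCounterexample

/-! ### Mixed modules and primeness of a minimal counterexample -/

/-- A proper module containing both an edge and a non-edge. -/
structure IsMixedModule (G : SimpleGraph V) (X : Set V) : Prop where
  isModule : IsModule G X
  ne_univ : X ≠ Set.univ
  exists_adj : ∃ x ∈ X, ∃ y ∈ X, G.Adj x y
  exists_not_adj : ∃ x ∈ X, ∃ y ∈ X, x ≠ y ∧ ¬ G.Adj x y

theorem IsMixedModule.compl {X : Set V} (h : IsMixedModule G X) : IsMixedModule Gᶜ X := by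
  refine ⟨h.isModule.compl, h.ne_univ, ?_, ?_⟩
  · obtain ⟨x, hx, y, hy, hxy⟩ := h.exists_not_adj
    exact ⟨x, hx, y, hy, (SimpleGraph.compl_adj _ _ _).2 hxy⟩
  · obtain ⟨x, hx, y, hy, hxy⟩ := h.exists_adj
    exact ⟨x, hx, y, hy, hxy.ne, fun h => ((SimpleGraph.compl_adj _ _ _).1 h).2 hxy⟩

theorem maximal_isMixedModule_compl {X : Set V} (h : Maximal (IsMixedModule G) X) :
    Maximal (IsMixedModule Gᶜ) X :=
  ⟨h.1.compl, fun Y hY hXY => h.2 (by simpa using hY.compl) hXY⟩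

/-- Adjacent vertices outside a module with a non-edge which are anticomplete to the module have the
same attachment to the neighbours of the module. -/
theorem IsModule.adj_of_adj (hF : ForkFree G) {X : Set V} (hX : IsModule G X) {c d a k l n : V}
    (hc : c ∈ X) (hd : d ∈ X) (hcd : c ≠ d) (hncd : ¬ G.Adj c d) (ha : a ∈ X) (hn : n ∉ X)
    (hk : k ∉ X) (hl : l ∉ X) (han : G.Adj a n) (hak : ¬ G.Adj a k) (hal : ¬ G.Adj a l)
    (hkl : G.Adj k l) (hnk : G.Adj n k) : G.Adj n l := by
  by_contra hnl
  have hom : ∀ {z x}, z ∉ X → x ∈ X → ¬ G.Adj a z → ¬ G.Adj x z := fun hz hx h h' =>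
    h (hX _ hz _ hx _ ha h'.symm).symm
  exact hF n c d k l hcd (hX n hn a ha c hc han.symm) (hX n hn a ha d hd han.symm) hnk hkl hncd
    (hom hk hc hak) (hom hk hd hak) (fun h => hnl h.symm) (fun h => hom hl hc hal h.symm)
    (fun h => hom hl hd hal h.symm)

/-- Complementary counterpart of `adj_of_adj`: `k` and `l` with the module edge `b c` form a
diamond, to which `n` would be pendant at `k`. -/
theorem IsModule.adj_of_not_adj (hK : KiteFree G) {X : Set V} (hX : IsModule G X) {b c a k l n : V}
    (hb : b ∈ X) (hc : c ∈ X) (hbc : G.Adj b c) (ha : a ∈ X) (hn : n ∉ X)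
    (hk : k ∉ X) (hl : l ∉ X) (han : ¬ G.Adj a n) (hak : G.Adj a k) (hal : G.Adj a l)
    (hne : k ≠ l) (hkl : ¬ G.Adj k l) (hnk : G.Adj n k) : G.Adj n l := by
  by_contra hnl
  have hom : ∀ {x}, x ∈ X → ¬ G.Adj n x := fun hx h => han (hX n hn _ hx a ha h).symm
  exact hK b c k l n hbc (hX k hk a ha b hb hak.symm) (hX k hk a ha c hc hak.symm)
    (hX l hl a ha b hb hal.symm) (hX l hl a ha c hc hal.symm) hnk hne hkl (hom hb) (hom hc) hnl

/-- Nonadjacent vertices anticomplete to a maximal mixed module attach differently to its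
neighbours. -/
theorem exists_distinguishing_nbr (hF : ForkFree G) (hK : KiteFree G)
    (hcut : ∀ X : Set V, X.Nonempty → X ≠ Set.univ → ∃ x ∈ X, ∃ y ∉ X, G.Adj x y) {X : Set V}
    (hX : Maximal (IsMixedModule G) X) {a d₁ d₂ : V} (ha : a ∈ X) (h1 : d₁ ∉ X) (h2 : d₂ ∉ X)
    (ha1 : ¬ G.Adj a d₁) (ha2 : ¬ G.Adj a d₂) (hne : d₁ ≠ d₂) (hn : ¬ G.Adj d₁ d₂) :
    ∃ n ∉ X, G.Adj a n ∧ ¬ (G.Adj n d₁ ↔ G.Adj n d₂) := by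
  by_contra! hsame
  have hmod := hX.1.isModule
  obtain ⟨b, hb, c, hc, hbc⟩ := hX.1.exists_adj
  obtain ⟨e, he, f, hf, hef, hnef⟩ := hX.1.exists_not_adj
  have hom : ∀ {z x}, z ∉ X → x ∈ X → G.Adj z x → G.Adj a z := fun hz hx h =>
    (hmod _ hz _ hx _ ha h).symm
  have hM : ∀ {n k l}, n ∉ X → k ∉ X → l ∉ X → G.Adj a n → ¬ G.Adj a k → ¬ G.Adj a l →
      G.Adj k l → G.Adj n k → G.Adj n l := fun hn hk hl h1 h2 h3 h4 h5 =>
    hmod.adj_of_adj hF he hf hef hnef ha hn hk hl h1 h2 h3 h4 h5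
  have hN : ∀ {n k l}, n ∉ X → k ∉ X → l ∉ X → ¬ G.Adj a n → G.Adj a k → G.Adj a l →
      k ≠ l → ¬ G.Adj k l → G.Adj n k → G.Adj n l := fun hn hk hl h1 h2 h3 h4 h5 h6 =>
    hmod.adj_of_not_adj hK hb hc hbc ha hn hk hl h1 h2 h3 h4 h5 h6
  by_cases hR : ∃ r ∉ X, G.Adj a r ∧ G.Adj r d₁
  · obtain ⟨r, hrX, har, hrd⟩ := hR
    -- `X ∪ T ∪ S` is a larger mixed module avoiding `r`, against maximality. Here `d₂ ∈ T` since it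
    -- attaches like `d₁`; the two are the fork leaves that exclude a non-neighbour of `X` attached
    -- to `S`.
    let T : Set V := {x | x ∉ X ∧ ¬ G.Adj a x ∧ ∀ n ∉ X, G.Adj a n → G.Adj n d₁ → G.Adj n x}
    let S : Set V := {x | x ∉ X ∧ G.Adj a x ∧ ¬ G.Adj x d₁}
    have hd1 : d₁ ∈ T := ⟨h1, ha1, fun _ _ _ h => h⟩
    have hd2 : d₂ ∈ T := ⟨h2, ha2, fun n hn han h => (hsame n hn han).1 h⟩
    have hRS : ∀ {n y}, n ∉ X → G.Adj a n → G.Adj n d₁ → y ∈ S → G.Adj n y := by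
      rintro n y hn han hnd ⟨hyX, hay, hyd⟩
      by_contra hny
      have hne : n ≠ y := by rintro rfl; exact hyd hnd
      exact hyd (hN h1 hn hyX ha1 han hay hne hny hnd.symm).symm
    have hMT : ∀ {v n y}, v ∉ X → ¬ G.Adj a v → n ∉ X → G.Adj a n → G.Adj n d₁ → ¬ G.Adj n v →
        y ∈ T → ¬ G.Adj v y := by
      rintro v n y hv hav hn han hnd hnv ⟨hyX, hay, hy⟩ hvy
      exact hnv (hM hn hyX hv han hay hav hvy.symm (hy n hn han hnd))
    have hmodY : IsModule G (X ∪ T ∪ S) := by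
      intro v hv x hx y hy hvx
      simp only [Set.mem_union, not_or] at hv
      obtain ⟨⟨hvX, hvT⟩, hvS⟩ := hv
      by_cases hav : G.Adj a v
      · have hvd : G.Adj v d₁ := by
          by_contra h
          exact hvS ⟨hvX, hav, h⟩
        rcases hy with (hyX | hyT) | hyS
        · exact hmod v hvX a ha y hyX hav.symm
        · exact hyT.2.2 v hvX hav hvd
        · exact hRS hvX hav hvd hyS
      · obtain ⟨n, hnX, han, hnd, hnv⟩ : ∃ n, n ∉ X ∧ G.Adj a n ∧ G.Adj n d₁ ∧ ¬ G.Adj n v := by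
          by_contra! h
          exact hvT ⟨hvX, hav, h⟩
        exfalso
        rcases hx with (hxX | hxT) | hxS
        · exact hav (hom hvX hxX hvx)
        · exact hMT hvX hav hnX han hnd hnv hxT hvx
        · have hxd₂ : ¬ G.Adj x d₂ := fun h => hxS.2.2 ((hsame x hxS.1 hxS.2.1).2 h)
          exact hF n d₁ d₂ x v hne hnd ((hsame n hnX han).1 hnd) (hRS hnX han hnd hxS) hvx.symm hn
            (fun h => hxS.2.2 h.symm) (fun h => hxd₂ h.symm) (fun h => hnv h.symm)
            (hMT hvX hav hnX han hnd hnv hd1) (hMT hvX hav hnX han hnd hnv hd2)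
    have hrY : r ∉ X ∪ T ∪ S := by
      rintro ((h | h) | h)
      exacts [hrX h, h.2.1 har, h.2.2 hrd]
    have hXY : X ⊆ X ∪ T ∪ S := fun x hx => Or.inl (Or.inl hx)
    exact h1 (hX.2 ⟨hmodY, fun h => hrY (h ▸ Set.mem_univ r), ⟨b, hXY hb, c, hXY hc, hbc⟩,
      ⟨e, hXY he, f, hXY hf, hef, hnef⟩⟩ hXY (Or.inl (Or.inr hd1)))
  · push Not at hR
    -- No edge leaves `Z`, against connectedness.
    let Z : Set V := {x | x ∉ X ∧ ¬ G.Adj a x ∧ ∀ n ∉ X, G.Adj a n → ¬ G.Adj n x}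
    have haZ : a ∉ Z := fun h => h.1 ha
    obtain ⟨x, hx, y, hy, hxy⟩ := hcut Z ⟨d₁, h1, ha1, hR⟩ (fun h => haZ (h ▸ Set.mem_univ a))
    by_cases hyX : y ∈ X
    · exact hx.2.1 (hom hx.1 hyX hxy)
    · by_cases hay : G.Adj a y
      · exact hx.2.2 y hyX hay hxy.symm
      · exact hy ⟨hyX, hay, fun n hn han hny =>
          hx.2.2 n hn han (hM hn hyX hx.1 han hay hx.2.1 hxy.symm hny)⟩

namespace IsMinCounterexample

variable {m : ℕ}

theorem not_isMixedModule [Finite V] (h : IsMinCounterexample G m) (hG : Uncluttered G) (X : Set V) :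
    ¬ IsMixedModule G X := by
  intro hX₀
  obtain ⟨X, -, hX⟩ := exists_maximal_ge_of_wellFoundedGT (IsMixedModule G) X hX₀
  clear hX₀
  have hF := hG.forkFree
  have hK := hG.kiteFree
  have hmod := hX.1.isModule
  obtain ⟨b, hb, c, hc, hbc⟩ := hX.1.exists_adj
  obtain ⟨e, he, f, hf, hef, hnef⟩ := hX.1.exists_not_adj
  have hN : ∀ {n k l}, n ∉ X → k ∉ X → l ∉ X → ¬ G.Adj b n → G.Adj b k → G.Adj b l →
      k ≠ l → ¬ G.Adj k l → G.Adj n k → G.Adj n l := fun hn hk hl h1 h2 h3 h4 h5 h6 =>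
    hmod.adj_of_not_adj hK hb hc hbc hb hn hk hl h1 h2 h3 h4 h5 h6
  have hM : ∀ {n k l}, n ∉ X → k ∉ X → l ∉ X → G.Adj b n → ¬ G.Adj b k → ¬ G.Adj b l →
      G.Adj k l → G.Adj n k → G.Adj n l := fun hn hk hl h1 h2 h3 h4 h5 =>
    hmod.adj_of_adj hF he hf hef hnef hb hn hk hl h1 h2 h3 h4 h5
  have hcutc : ∀ X : Set V, X.Nonempty → X ≠ Set.univ → ∃ x ∈ X, ∃ y ∉ X, Gᶜ.Adj x y := by
    intro Y hY hY'
    obtain ⟨x, hx, y, hy, hxy⟩ := h.exists_not_adj_of_cut hY hY'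
    exact ⟨x, hx, y, hy, (SimpleGraph.compl_adj _ _ _).2 ⟨fun e => hy (e ▸ hx), hxy⟩⟩
  have hbX : ∀ {z}, z ∉ X → b ≠ z := fun hz e => hz (e ▸ hb)
  -- adjacent neighbours of the module attach differently to its non-neighbours
  have hdist : ∀ {k l}, k ∉ X → l ∉ X → G.Adj b k → G.Adj b l → G.Adj k l →
      ∃ n ∉ X, ¬ G.Adj b n ∧ ¬ (G.Adj n k ↔ G.Adj n l) := by
    intro k l hk hl hbk hbl hkl
    obtain ⟨n, hn, hbn, hnkl⟩ := exists_distinguishing_nbr hG.compl.forkFree hG.compl.kiteFree hcutc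
      (maximal_isMixedModule_compl hX) hb hk hl
      (fun h => ((SimpleGraph.compl_adj _ _ _).1 h).2 hbk)
      (fun h => ((SimpleGraph.compl_adj _ _ _).1 h).2 hbl) hkl.ne
      (fun h => ((SimpleGraph.compl_adj _ _ _).1 h).2 hkl)
    have hbn' := ((SimpleGraph.compl_adj _ _ _).1 hbn).2
    refine ⟨n, hn, hbn', fun hiff => hnkl ?_⟩
    have hnk : n ≠ k := by rintro rfl; exact hbn' hbk
    have hnl : n ≠ l := by rintro rfl; exact hbn' hbl
    simp [SimpleGraph.compl_adj, hnk, hnl, hiff]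
  -- For nonadjacent `k`, `l`, take `z` adjacent to `k` only. If `z` is a neighbour of `X`, the
  -- non-edges `k l` and `l z` make `k` and `z` attach alike, against `hdist`; if not, `hN` makes it
  -- adjacent to `l`.
  have hclique : ∀ {k l}, k ∉ X → l ∉ X → G.Adj b k → G.Adj b l → k ≠ l → G.Adj k l := by
    intro k l hk hl hbk hbl hkl
    by_contra hnkl
    obtain ⟨z, hkz, hlz⟩ := h.not_dominated hkl hnkl
    by_cases hzX : z ∈ X
    · exact hlz (hmod l hl b hb z hzX hbl.symm)
    · by_cases hbz : G.Adj b z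
      · obtain ⟨n, hn, hbn, hnkz⟩ := hdist hk hzX hbk hbz hkz
        have hlz' : l ≠ z := by rintro rfl; exact hnkl hkz
        have hnlk : ¬ G.Adj l k := fun h => hnkl h.symm
        have hnzl : ¬ G.Adj z l := fun h => hlz h.symm
        exact hnkz ⟨fun h => hN hn hl hzX hbn hbl hbz hlz' hlz (hN hn hk hl hbn hbk hbl hkl hnkl h),
          fun h => hN hn hl hk hbn hbl hbk hkl.symm hnlk
            (hN hn hzX hl hbn hbz hbl hlz'.symm hnzl h)⟩
      · exact hlz (hN hzX hk hl hbz hbk hbl hkl hnkl hkz.symm).symm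
  obtain ⟨x, hx, d, hd, hxd⟩ := h.exists_not_adj_of_cut ⟨b, hb⟩ hX.1.ne_univ
  have hbd : ¬ G.Adj b d := fun h => hxd (hmod d hd b hb x hx h.symm).symm
  -- If neither `k` nor `l` sees `X`, the path `k - d - l` forces equal attachments, against
  -- `exists_distinguishing_nbr`; otherwise `hclique` or `hM` makes them adjacent.
  obtain ⟨k, l, hdk, hdl, hkl, hnkl⟩ := h.not_clique_nbrs d
  have hkX : k ∉ X := fun hkX => hbd (hmod d hd k hkX b hb hdk).symm
  have hlX : l ∉ X := fun hlX => hbd (hmod d hd l hlX b hb hdl).symm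
  by_cases hbk : G.Adj b k <;> by_cases hbl : G.Adj b l
  · exact hnkl (hclique hkX hlX hbk hbl hkl)
  · exact hnkl (hM hkX hd hlX hbk hbd hbl hdl hdk.symm)
  · exact hnkl (hM hlX hd hkX hbl hbd hbk hdk hdl.symm).symm
  · obtain ⟨n, hn, hbn, hnkl'⟩ := exists_distinguishing_nbr hF hK
      (fun _ h1 h2 => h.exists_adj_of_cut h1 h2) hX hb hkX hlX hbk hbl hkl hnkl
    exact hnkl' ⟨fun h => hM hn hd hlX hbn hbd hbl hdl (hM hn hkX hd hbn hbk hbd hdk.symm h),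
      fun h => hM hn hd hkX hbn hbd hbk hdk (hM hn hlX hd hbn hbl hbd hdl.symm h)⟩

/-- A nontrivial proper module of a minimal counterexample is a clique. -/
theorem isClique_of_isModule [Finite V] (h : IsMinCounterexample G m) (hG : Uncluttered G) {X : Set V}
    (hX : IsModule G X) (hne : X ≠ Set.univ) {x y : V} (hx : x ∈ X) (hy : y ∈ X) (hxy : x ≠ y) :
    G.Adj x y := by
  by_contra hnxy
  obtain ⟨z, hxz, hyz⟩ := h.not_dominated hxy hnxy
  by_cases hz : z ∈ X
  · exact h.not_isMixedModule hG X ⟨hX, hne, ⟨x, hx, z, hz, hxz⟩, ⟨x, hx, y, hy, hxy, hnxy⟩⟩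
  · exact hyz (hX z hz x hx y hy hxz.symm).symm

/-- A minimal counterexample is prime. -/
theorem isPrime [Finite V] (h : IsMinCounterexample G m) (hG : Uncluttered G) : IsPrime G := by
  intro X hX hne a ha b hb
  by_contra hab
  have hadj := h.isClique_of_isModule hG hX hne ha hb hab
  obtain ⟨k, l, hak, hal, hkl, hnkl⟩ := h.not_clique_nbrs a
  have hkX : k ∉ X := by
    intro hk
    by_cases hl : l ∈ X
    · exact hnkl (h.isClique_of_isModule hG hX hne hk hl hkl)
    · exact hnkl (hX l hl a ha k hk hal.symm).symm
  have hlX : l ∉ X := fun hl => hnkl (hX k hkX a ha l hl hak.symm)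
  have hN : ∀ {n k l}, n ∉ X → k ∉ X → l ∉ X → ¬ G.Adj a n → G.Adj a k → G.Adj a l →
      k ≠ l → ¬ G.Adj k l → G.Adj n k → G.Adj n l := fun hn hk hl h1 h2 h3 h4 h5 h6 =>
    hX.adj_of_not_adj hG.kiteFree ha hb hadj ha hn hk hl h1 h2 h3 h4 h5 h6
  -- `Y` is a module containing the non-edge `k l`: by `hN`, a neighbour of `a` outside `X` that
  -- misses some vertex of `Y` attaches like `k` and so lies in `Y`.
  let Y : Set V := {y | y ∉ X ∧ G.Adj a y ∧ ∀ n ∉ X, ¬ G.Adj a n → (G.Adj n y ↔ G.Adj n k)}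
  have haY : a ∉ Y := fun h => h.1 ha
  have hkY : k ∈ Y := ⟨hkX, hak, fun _ _ _ => Iff.rfl⟩
  have hlY : l ∈ Y := ⟨hlX, hal, fun n hn han =>
    ⟨hN hn hlX hkX han hal hak hkl.symm (fun h => hnkl h.symm), hN hn hkX hlX han hak hal hkl hnkl⟩⟩
  refine hnkl (h.isClique_of_isModule hG (X := Y) ?_ (fun h => haY (h ▸ Set.mem_univ a)) hkY hlY hkl)
  intro v hv x hx y hy hvx
  by_cases hvX : v ∈ X
  · exact (hX y hy.1 a ha v hvX hy.2.1.symm).symm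
  · by_cases hav : G.Adj a v
    · by_contra hvy
      have hne : v ≠ y := by rintro rfl; exact hv hy
      exact hv ⟨hvX, hav, fun n hn han => Iff.trans
        ⟨hN hn hvX hy.1 han hav hy.2.1 hne hvy,
          hN hn hy.1 hvX han hy.2.1 hav hne.symm (fun h => hvy h.symm)⟩ (hy.2.2 n hn han)⟩
    · exact (hy.2.2 v hvX hav).2 ((hx.2.2 v hvX hav).1 hvx)

/-! ### Contradiction and the final induction -/

theorem false_of_uncluttered [Finite V] (h : IsMinCounterexample G m) (hG : Uncluttered G) : False := by
  have hP := h.isPrime hG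
  by_cases hc : ∃ v s, IsClawAt G v s
  · obtain ⟨v, s, hs⟩ := hc
    exact h.not_bipartiteOn_nonNbrs v (hs.bipartiteOn_nonNbrs hG hP)
  · push Not at hc
    have hV : Nonempty V := by
      by_contra hV
      rw [not_nonempty_iff] at hV
      exact h.not_colorable ⟨fun _ => 0, fun x => hV.elim x, fun x => hV.elim x⟩
    obtain ⟨v⟩ := hV
    -- A 2-colouring of the non-neighbours of `v` in the complement partitions `N(v)` into two
    -- cliques of `G`.
    obtain ⟨f, hf⟩ := bipartiteOn_nonNbrs_of_no_compl_claw hG.compl.forkFree hP.compl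
      (by simpa using hc) v
    have hmem : ∀ x, G.Adj v x → x ∈ nonNbrs Gᶜ v := fun x hx =>
      ⟨hx.ne', fun h => ((SimpleGraph.compl_adj _ _ _).1 h).2 hx⟩
    refine h.not_two_cliques v f ?_
    intro x y hx hy hxy he
    by_contra hn
    exact hf x (hmem x hx) y (hmem y hy) ((SimpleGraph.compl_adj _ _ _).2 ⟨hxy, hn⟩) he

end IsMinCounterexample

theorem cliqueNum_induce_le_of_cliquesLE [Finite V] {s : Set V} {k : ℕ} (h : CliquesLE G s k) :
    (G.induce s).cliqueNum ≤ k := by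
  obtain ⟨t, ht⟩ := (G.induce s).exists_isNClique_cliqueNum
  rw [← ht.card_eq, ← Finset.card_map (Function.Embedding.subtype _)]
  refine h _ (by intro x; simp; tauto) ?_
  have := ht.isClique
  intro x hx y hy hxy
  simp only [Finset.coe_map, Set.mem_image, Finset.mem_coe] at hx hy
  obtain ⟨a, ha, rfl⟩ := hx
  obtain ⟨b, hb, rfl⟩ := hy
  exact this ha hb (fun e => hxy (e ▸ rfl))

theorem colorableOn_of_colorable_induce {s : Set V} {k : ℕ} (h : (G.induce s).Colorable k) :
    ColorableOn G s k := by
  classical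
  obtain ⟨c⟩ := h
  refine ⟨fun x => if hx : x ∈ s then c ⟨x, hx⟩ else 0, fun x hx => by simp [hx], ?_⟩
  intro x hx y hy hxy
  simp only [hx, hy, dif_pos]
  have : (G.induce s).Adj ⟨x, hx⟩ ⟨y, hy⟩ := hxy
  exact fun e => c.valid this (Fin.ext e)

theorem colorable_of_colorableOn_univ {k : ℕ} (h : ColorableOn G Set.univ k) : G.Colorable k := by
  obtain ⟨f, hf, hf'⟩ := h
  exact ⟨SimpleGraph.Coloring.mk (fun x => ⟨f x, hf x trivial⟩)
    (fun {x y} hxy e => hf' x trivial y trivial hxy (congrArg Fin.val e))⟩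

/-- The vertex type is quantified inside the induction because induced subgraphs live on subtypes.
-/
theorem colorable_two_mul_cliqueNum.{u} (n : ℕ) : ∀ (V : Type u) [Finite V] (G : SimpleGraph V),
    Uncluttered G → Nat.card V = n → G.Colorable (2 * G.cliqueNum) := by
  induction n using Nat.strong_induction_on with
  | _ n ih =>
    intro V _ G hG hn
    by_contra hcol
    refine IsMinCounterexample.false_of_uncluttered (G := G) (m := G.cliqueNum) ⟨?_, ?_, ?_⟩ hG
    · intro t _ ht
      exact SimpleGraph.IsClique.card_le_cliqueNum (tc := ht)
    · exact fun h => hcol (colorable_of_colorableOn_univ h)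
    · intro s hs k hk
      have hcard : Nat.card s < n := by
        rw [← hn, ← Set.ncard_univ V]
        exact Set.ncard_lt_ncard (Set.ssubset_univ_iff.2 hs)
      have := ih _ hcard s (G.induce s) (hG.induce s) rfl
      exact colorableOn_of_colorable_induce
        (this.mono (Nat.mul_le_mul_left 2 (cliqueNum_induce_le_of_cliquesLE hk)))

end Uncluttered

theorem theorem1p1 {V : Type*} [Finite V] (G : SimpleGraph V) (hG : Uncluttered G) :
    G.chromaticNumber ≤ 2 * (G.cliqueNum : ℕ∞) := by
  have h := (Uncluttered.colorable_two_mul_cliqueNum _ V G hG rfl).chromaticNumber_le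
  exact_mod_cast h
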